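/- Let $k$ be a commutative ring with unit, $s\ge 1$ an integer and $R$ a commutative unital $k$-algebra. Let $\mathfrak M^s(R)$ be the set of formal power series $f=\sum_{|w|\ge 1} f_w z_w$ without constant term in $s$ non-commuting variables $z_1,\dots,z_s$, where $f_w\in R$, $w$ runs over the non-empty words over $\{1,\dots,s\}$ and $z_{(i_1\dots i_n)}=z_{i_1}\cdots z_{i_n}$; let $+$ be coefficientwise addition, and let $\mathfrak G^s(R)\subseteq\mathfrak M^s(R)$ be the subset of those $f$ whose degree-one coefficients $f_{(1)},\dots,f_{(s)}$ are all units of $R$. A $k$-algebra homomorphism $\varphi:R\to R'$ acts on coefficients, giving maps $\mathfrak M^s(R)\to\mathfrak M^s(R')$ and $\mathfrak G^s(R)\to\mathfrak G^s(R')$. For a word $w=(i_1\dots i_n)$ and a partition $\pi$ of $\{1,\dots,n\}$ put $f_{w,\pi}:=\prod_{V\in\pi} f_{w|V}$, where $w|V=(i_{v_1}\dots i_{v_m})$ for a block $V=\{v_1<\dots<v_m\}$. The boxed convolution $\boxtimes$ is the operation on $\mathfrak M^s(R)$ given by $$(f\boxtimes g)_w=\sum_{\pi\in\operatorname{NC}(n)}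 f_{w,\pi}\, g_{w,K(\pi)},\qquad n=|w|\ge 1,$$ where $\operatorname{NC}(n)$ is the set of non-crossing partitions of $\{1,\dots,n\}$ and $K(\pi)$ is the Kreweras complement of $\pi$, i.e. the greatest (for the order in which $\sigma\le\tau$ if every block of $\sigma$ lies in a block of $\tau$) non-crossing partition of $\{\bar 1,\dots,\bar n\}\cong\{1,\dots,n\}$ such that $\pi\cup K(\pi)$ is a non-crossing partition of the ordered set $1<\bar 1<2<\bar 2<\dots<n<\bar n$. Let $\operatorname{Zeta}_s=\sum_{|w|\ge1} z_w$ be the series with all coefficients equal to $1$. It has a unique two-sided $\boxtimes$-inverse $\operatorname{Moeb}_s$, that is, $\operatorname{Moeb}_s\boxtimes\operatorname{Zeta}_s=\operatorname{Zeta}_s\boxtimes\operatorname{Moeb}_s=z_1+\dots+z_s$. Define on $\mathfrak M^s(R)$ $$f\boxplus_V g:=\bigl(f\boxtimes\operatorname{Moeb}_s+g\boxtimes\operatorname{Moeb}_s\bigr)\boxtimes\operatorname{Zeta}_s,\qquad f\boxtimes_V g:=(f\boxtimes\operatorname{Moeb}_s)\boxtimes g .$$ Then: 1. $(\mathfrak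 M^s(R),\boxplus_V)$ is an abelian group with neutral element $0$. 2. $(\mathfrak G^s(R),\boxtimes_V)$ is a group with neutral element $\operatorname{Zeta}_s$. For $s=1$ it is abelian; for $s\ge 2$ and $R\ne 0$ it is non-abelian. 3. $(\mathfrak M^s(R),+)$ is a group with neutral element $0$, $(\mathfrak G^s(R),\boxtimes)$ is a group with neutral element $z_1+\dots+z_s$, and right $\boxtimes$-multiplication $f\mapsto f\boxtimes\operatorname{Zeta}_s$ restricts to isomorphisms of groups $$(\mathfrak M^s(R),+)\cong(\mathfrak M^s(R),\boxplus_V)\qquad\text{and}\qquad(\mathfrak G^s(R),\boxtimes)\cong(\mathfrak G^s(R),\boxtimes_V),$$ which are natural in $R$: for every homomorphism $\varphi:R\to R'$ of commutative $k$-algebras the coefficientwise maps induced by $\varphi$ respect $+$, $\boxtimes$, $\boxplus_V$ and $\boxtimes_V$, and commute with right $\boxtimes$-multiplication by $\operatorname{Zeta}_s$. -/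

import Mathlib

/-! ### Non-crossing partitions and the Kreweras complement -/

/-- The set partitions of `[n]`, modelled on `Fin n`. -/
abbrev SetPartition (n : ℕ) : Type := Finpartition (Finset.univ : Finset (Fin n))

/-- `p` and `q` lie in the same block of `π`. -/
def SameBlock {n : ℕ} (π : SetPartition n) (p q : Fin n) : Prop :=
  ∃ V ∈ π.parts, p ∈ V ∧ q ∈ V

/-- A relation on an ordered set is non-crossing: there are no `p₁ < q₁ < p₂ < q₂` with
`p₁ ∼ p₂` and `q₁ ∼ q₂` but not `p₂ ∼ q₁`. -/
def NonCrossing {ι : Type*} [LT ι] (r : ι → ι → Prop) : Prop :=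
  ∀ p₁ q₁ p₂ q₂ : ι, p₁ < q₁ → q₁ < p₂ → p₂ < q₂ → r p₁ p₂ → r q₁ q₂ → r p₂ q₁

open Classical in
/-- The finite set `NC(n)` of non-crossing partitions of `[n]`. -/
noncomputable def NC (n : ℕ) : Finset (SetPartition n) :=
  Finset.univ.filter fun π => NonCrossing (SameBlock π)

/-- The relation of the partition `π ∪ σ` of the ordered set `1 < 1̄ < 2 < 2̄ < ⋯ < n < n̄`, where
`π` is placed on the unbarred points `(i, false)` and `σ` on the barred points `(i, true)`. -/
def InterleavedBlock {n : ℕ} (π σ : SetPartition n) (x y : Fin n ×ₗ Bool) : Prop :=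
  ((ofLex x).2 = false ∧ (ofLex y).2 = false ∧ SameBlock π (ofLex x).1 (ofLex y).1) ∨
  ((ofLex x).2 = true ∧ (ofLex y).2 = true ∧ SameBlock σ (ofLex x).1 (ofLex y).1)

/-- The equivalence relation of the Kreweras complement: `ī ∼ j̄` when no block of `π` has a point
strictly between `ī` and `j̄` and also a point outside, a point `a` being strictly between them
exactly when `a ≤ i` and `a ≤ j` are not equivalent. -/
def krewerasSetoid {n : ℕ} (π : SetPartition n) : Setoid (Fin n) where
  r i j := ∀ a b : Fin n, SameBlock π a b → ((a ≤ i ↔ a ≤ j) ↔ (b ≤ i ↔ b ≤ j))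
  iseqv :=
    { refl := fun _ _ _ _ => by simp
      symm := fun h a b hab => by have := h a b hab; tauto
      trans := fun h₁ h₂ a b hab => by
        have := h₁ a b hab
        have := h₂ a b hab
        tauto }

open Classical in
/-- The Kreweras complement `K(π)`, with `[n̄]` identified with `[n]`; that it is the greatest
non-crossing `σ` with `π ∪ σ` non-crossing is `kreweras_isGreatest`. -/
noncomputable def kreweras {n : ℕ} (π : SetPartition n) : SetPartition n :=
  Finpartition.ofSetoid (krewerasSetoid π)

theorem sameBlock_kreweras {n : ℕ} (π : SetPartition n) (i j : Fin n) :
    SameBlock (kreweras π) i j ↔ krewerasSetoid π i j := by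
  classical
  constructor
  · rintro ⟨V, hV, hi, hj⟩
    have h := (kreweras π).part_eq_of_mem hV hi
    rw [← h] at hj
    exact Finpartition.mem_part_ofSetoid_iff_rel.1 hj
  · intro h
    refine ⟨(kreweras π).part i, (kreweras π).part_mem.2 (Finset.mem_univ i),
      (kreweras π).mem_part (Finset.mem_univ i), ?_⟩
    exact Finpartition.mem_part_ofSetoid_iff_rel.2 h

theorem kreweras_isGreatest {n : ℕ} {π : SetPartition n} (hπ : π ∈ NC n) :
    IsGreatest {σ : SetPartition n | σ ∈ NC n ∧ NonCrossing (InterleavedBlock π σ)}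
      (kreweras π) := by
  have lex (x y : Fin n ×ₗ Bool) : x < y ↔ (ofLex x).1 < (ofLex y).1 ∨
      ((ofLex x).1 = (ofLex y).1 ∧ (ofLex x).2 < (ofLex y).2) := Prod.Lex.lt_iff
  have hB : ¬ (true < false) := by decide
  have hπ' : NonCrossing (SameBlock π) := by simpa [NC] using hπ
  have hsymm {σ : SetPartition n} {a b : Fin n} (h : SameBlock σ a b) : SameBlock σ b a := by
    obtain ⟨V, hV, ha, hb⟩ := h
    exact ⟨V, hV, hb, ha⟩
  refine ⟨⟨?_, ?_⟩, ?_⟩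
  · simp only [NC, Finset.mem_filter, Finset.mem_univ, true_and]
    intro i j k l hij hjk hkl h₁ h₂
    rw [sameBlock_kreweras] at h₁ h₂ ⊢
    intro a b hab
    have := h₁ a b hab
    have := h₂ a b hab
    grind
  · intro x y z t hxy hyz hzt h₁ h₂
    rw [lex] at hxy hyz hzt
    rcases h₁ with ⟨hx, hz, h₁⟩ | ⟨hx, hz, h₁⟩ <;> rcases h₂ with ⟨hy, ht, h₂⟩ | ⟨hy, ht, h₂⟩
    · simp only [hx, hy, hz, ht, lt_self_iff_false, and_false, or_false] at hxy hyz hzt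
      exact Or.inl ⟨hz, hy, hπ' _ _ _ _ hxy hyz hzt h₁ h₂⟩
    · exfalso
      rw [sameBlock_kreweras] at h₂
      have := h₂ _ _ h₁
      simp only [hx, hy, hz, ht, hB, and_false, or_false] at hxy hyz hzt
      grind
    · exfalso
      rw [sameBlock_kreweras] at h₁
      have := h₁ _ _ h₂
      simp only [hx, hy, hz, ht, hB, and_false, or_false] at hxy hyz hzt
      grind
    · refine Or.inr ⟨hz, hy, ?_⟩
      simp only [hx, hy, hz, ht, lt_self_iff_false, and_false, or_false] at hxy hyz hzt
      rw [sameBlock_kreweras] at h₁ h₂ ⊢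
      intro a b hab
      have := h₁ a b hab
      have := h₂ a b hab
      grind
  · rintro σ ⟨-, hσ⟩ V hV
    obtain ⟨i, hi⟩ := σ.nonempty_of_mem_parts hV
    have key (i j a b : Fin n) (hij : SameBlock σ i j) (hab : SameBlock π a b) (hia : i < a)
        (haj : a ≤ j) : i < b ∧ b ≤ j := by
      by_contra hb
      rcases lt_or_ge i b with hib | hbi
      · have hjb : j < b := by
          by_contra h
          exact hb ⟨hib, not_lt.1 h⟩
        have := hσ (toLex (i, true)) (toLex (a, false)) (toLex (j, true)) (toLex (b, false))
          (by simp [lex, hia]) (by rcases haj.lt_or_eq with h | h <;> simp [lex, h])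
          (by simp [lex, hjb])
          (Or.inr ⟨rfl, rfl, hij⟩) (Or.inl ⟨rfl, rfl, hab⟩)
        simp [InterleavedBlock] at this
      · have := hσ (toLex (b, false)) (toLex (i, true)) (toLex (a, false)) (toLex (j, true))
          (by rcases hbi.lt_or_eq with h | h <;> simp [lex, h]) (by simp [lex, hia])
          (by rcases haj.lt_or_eq with h | h <;> simp [lex, h])
          (Or.inl ⟨rfl, rfl, hsymm hab⟩) (Or.inr ⟨rfl, rfl, hij⟩)
        simp [InterleavedBlock] at this
    refine ⟨(kreweras π).part i, (kreweras π).part_mem.2 (Finset.mem_univ i), fun j hj => ?_⟩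
    classical
    refine Finpartition.mem_part_ofSetoid_iff_rel.2 fun a b hab => ?_
    have hij : SameBlock σ i j := ⟨V, hV, hi, hj⟩
    have h₁ := key i j a b hij hab
    have h₂ := key i j b a hij (hsymm hab)
    have h₃ := key j i a b (hsymm hij) hab
    have h₄ := key j i b a (hsymm hij) (hsymm hab)
    grind

/-! ### Power series in non-commuting variables without constant term -/

/-- `R₊⟨⟨z₁, …, z_s⟩⟩ = 𝔐ˢ(R)`: the series `∑_{|w| ≥ 1} α_w z_w`, given by their coefficients,
which are indexed by the non-empty words over `[s]`. Addition is coefficientwise. -/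
abbrev MSeries (s : ℕ) (R : Type*) : Type _ := {w : List (Fin s) // w ≠ []} → R

/-- The set `𝔊ˢ(R)` of the series whose coefficients of degree one are units. -/
def GSeries (s : ℕ) (R : Type*) [CommRing R] : Set (MSeries s R) :=
  {f | ∀ i : Fin s, IsUnit (f ⟨[i], List.cons_ne_nil i []⟩)}

/-- The map `𝔐ˢ(φ)`, which applies `φ` to every coefficient. -/
def MSeries.map {s : ℕ} {R R' : Type*} (φ : R → R') (f : MSeries s R) : MSeries s R' :=
  fun w => φ (f w)

/-- The coefficient `X_w(f)`, for any word `w`; it vanishes for the empty word. -/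
def coeffAt {s : ℕ} {R : Type*} [CommRing R] (f : MSeries s R) (w : List (Fin s)) : R :=
  if h : w ≠ [] then f ⟨w, h⟩ else 0

/-- The restriction `w|V`: the subword of `w` at the positions in `V`, in increasing order. -/
def restrictWord {s : ℕ} (w : List (Fin s)) (V : Finset (Fin w.length)) : List (Fin s) :=
  (V.sort (· ≤ ·)).map w.get

/-- `X_{w,π}(f)`, the product of the `X_{w|V}(f)` over the blocks `V` of `π`. -/
def coeffPart {s : ℕ} {R : Type*} [CommRing R] (f : MSeries s R) (w : List (Fin s))
    (π : SetPartition w.length) : R :=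
  ∏ V ∈ π.parts, coeffAt f (restrictWord w V)

/-- The boxed convolution `f ⊠ g`. -/
noncomputable def boxConv {s : ℕ} {R : Type*} [CommRing R] (f g : MSeries s R) : MSeries s R :=
  fun w => ∑ π ∈ NC w.1.length, coeffPart f w.1 π * coeffPart g w.1 (kreweras π)

/-- The series `z₁ + ⋯ + z_s`. -/
def boxUnit (s : ℕ) (R : Type*) [CommRing R] : MSeries s R :=
  fun w => if w.1.length = 1 then 1 else 0

/-- `Zeta_s`, the series all of whose coefficients are `1`. -/
def Zeta (s : ℕ) (R : Type*) [CommRing R] : MSeries s R := fun _ => 1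

/-- `m` is a two-sided inverse of `Zeta_s` with respect to `⊠`. -/
def IsMoebius {s : ℕ} {R : Type*} [CommRing R] (m : MSeries s R) : Prop :=
  boxConv m (Zeta s R) = boxUnit s R ∧ boxConv (Zeta s R) m = boxUnit s R

/-- `Moeb_s`, the inverse of `Zeta_s` with respect to `⊠`. -/
noncomputable def Moeb (s : ℕ) (R : Type*) [CommRing R] : MSeries s R :=
  Classical.epsilon fun m : MSeries s R => IsMoebius m

/-- `f ⊞_V g = (f ⊠ Moeb_s + g ⊠ Moeb_s) ⊠ Zeta_s`. -/
noncomputable def boxPlusV {s : ℕ} {R : Type*} [CommRing R] (f g : MSeries s R) : MSeries s R :=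
  boxConv (boxConv f (Moeb s R) + boxConv g (Moeb s R)) (Zeta s R)

/-- `f ⊠_V g = f ⊠ Moeb_s ⊠ g`. -/
noncomputable def boxTimesV {s : ℕ} {R : Type*} [CommRing R] (f g : MSeries s R) : MSeries s R :=
  boxConv (boxConv f (Moeb s R)) g

/-! ### Groups given by an operation on a set -/

/-- `S` is closed under `op` and is a group under `op`, with neutral element `e`. -/
def IsGroupOn {M : Type*} (S : Set M) (op : M → M → M) (e : M) : Prop :=
  ∃ _ : Group S, (∀ f g : S, ((f * g : S) : M) = op f g) ∧ ((1 : S) : M) = e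

/-- `op` is commutative on `S`. -/
def IsAbelianOn {M : Type*} (S : Set M) (op : M → M → M) : Prop :=
  ∀ f ∈ S, ∀ g ∈ S, op f g = op g f

/-- `F` maps `S` bijectively onto `T` and carries the operation `op` on `S` to `op'` on `T`. -/
def IsGroupIsoOn {M N : Type*} (S : Set M) (op : M → M → M) (T : Set N) (op' : N → N → N)
    (F : M → N) : Prop :=
  Set.BijOn F S T ∧ ∀ f ∈ S, ∀ g ∈ S, F (op f g) = op' (F f) (F g)

/-! ### Set partitions as equivalence relations -/

section SetPartition

variable {n m : ℕ} {π σ τ : SetPartition n} {i j k : Fin n}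

/-! The series form a monoid under `⊠`, with unit `boxUnit`, in which every element of `GSeries` is
invertible. Once this is known, right multiplication by `Zeta` is a bijection with inverse right
multiplication by `Moeb`, and `boxPlusV` and `boxTimesV` are `+` and `⊠` transported along it, so
the group laws and isomorphisms are formal.

Associativity (`boxConv_assoc`) is the main point. For `π ≤ σ` non-crossing, taking Kreweras
complements of `π` inside each block of `σ` gives `σ ⊓ K(π)` (`comap_inf_kreweras`). Hence `(f ⊠ g)
⊠ h` is a sum over pairs `π ≤ σ`, with `f` on `π`, `g` on `σ ⊓ K(π)` and `h` on `K(σ)`, while `f ⊠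
(g ⊠ h)` is a sum over pairs `τ ≤ K(π)`, with `h` on `K(π) ⊓ K(τ)`. The substitution `τ = σ ⊓ K(π)`
matches them because `K(σ ⊓ K(π)) ⊓ K(π) = K(σ)` (`kreweras_inf_kreweras`) and `K` is injective on
`NC` (`kreweras_injOn`).

Inverses are found by recursion on word length (`exists_left_inverse`). In one variable, `K`
followed by reversal is an involution of `NC` that exchanges the two factors (`boxConv_comm`). In
several variables, adding `xy` and `yx` respectively to the unit gives two series whose products in
the two orders differ at the word `xyx`. Naturality holds because coefficients of `⊠` are sums of
products and `Moeb` is unique. -/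

theorem SameBlock.refl (π : SetPartition n) (i : Fin n) : SameBlock π i i :=
  ⟨π.part i, π.part_mem.2 (Finset.mem_univ i), π.mem_part (Finset.mem_univ i),
    π.mem_part (Finset.mem_univ i)⟩

theorem SameBlock.symm (h : SameBlock π i j) : SameBlock π j i := by
  obtain ⟨V, hV, hi, hj⟩ := h
  exact ⟨V, hV, hj, hi⟩

theorem SameBlock.trans (h : SameBlock π i j) (h' : SameBlock π j k) : SameBlock π i k := by
  obtain ⟨V, hV, hi, hj⟩ := h
  obtain ⟨W, hW, hj', hk⟩ := h'
  exact ⟨V, hV, hi, π.eq_of_mem_parts hV hW hj hj' ▸ hk⟩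

theorem SameBlock.mem {V : Finset (Fin n)} (h : SameBlock π i j) (hV : V ∈ π.parts) (hi : i ∈ V) :
    j ∈ V := by
  obtain ⟨W, hW, hi', hj⟩ := h
  exact π.eq_of_mem_parts hV hW hi hi' ▸ hj

theorem SameBlock.of_mem {V : Finset (Fin n)} (hV : V ∈ π.parts) (hi : i ∈ V) (hj : j ∈ V) :
    SameBlock π i j := ⟨V, hV, hi, hj⟩

theorem SetPartition.le_iff : π ≤ σ ↔ ∀ i j, SameBlock π i j → SameBlock σ i j := by
  constructor
  · rintro h i j ⟨V, hV, hi, hj⟩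
    obtain ⟨W, hW, hVW⟩ := h hV
    exact ⟨W, hW, hVW hi, hVW hj⟩
  · intro h V hV
    obtain ⟨i, hi⟩ := π.nonempty_of_mem_parts hV
    obtain ⟨W, hW, hiW, -⟩ := SameBlock.refl σ i
    exact ⟨W, hW, fun j hj => (h i j ⟨V, hV, hi, hj⟩).mem hW hiW⟩

theorem SetPartition.ext (h : ∀ i j, SameBlock π i j ↔ SameBlock σ i j) : π = σ :=
  le_antisymm (le_iff.2 fun i j => (h i j).1) (le_iff.2 fun i j => (h i j).2)

theorem sameBlock_inf : SameBlock (σ ⊓ τ) i j ↔ SameBlock σ i j ∧ SameBlock τ i j := by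
  refine ⟨fun h => ⟨SetPartition.le_iff.1 inf_le_left i j h,
    SetPartition.le_iff.1 inf_le_right i j h⟩, ?_⟩
  rintro ⟨⟨V, hV, hi, hj⟩, W, hW, hi', hj'⟩
  refine ⟨V ∩ W, ?_, by simp [hi, hi'], by simp [hj, hj']⟩
  rw [Finpartition.parts_inf, Finset.mem_erase]
  exact ⟨Finset.ne_empty_of_mem (Finset.mem_inter.2 ⟨hi, hi'⟩),
    Finset.mem_image.2 ⟨(V, W), by simp [hV, hW], rfl⟩⟩

open Classical in
/-- The set partition into the classes of an equivalence relation. -/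
noncomputable def setPartitionOf (r : Setoid (Fin n)) : SetPartition n :=
  Finpartition.ofSetoid r

theorem sameBlock_setPartitionOf {r : Setoid (Fin n)} :
    SameBlock (setPartitionOf r) i j ↔ r i j := by
  classical
  constructor
  · rintro ⟨V, hV, hi, hj⟩
    rw [← (setPartitionOf r).part_eq_of_mem hV hi] at hj
    exact Finpartition.mem_part_ofSetoid_iff_rel.1 hj
  · exact fun h => ⟨(setPartitionOf r).part i, (setPartitionOf r).part_mem.2 (Finset.mem_univ i),
      (setPartitionOf r).mem_part (Finset.mem_univ i), Finpartition.mem_part_ofSetoid_iff_rel.2 h⟩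

/-- Lying in the same block, as an equivalence relation. -/
def SetPartition.setoid (π : SetPartition n) : Setoid (Fin n) where
  r := SameBlock π
  iseqv := ⟨SameBlock.refl π, SameBlock.symm, SameBlock.trans⟩

/-- The partition pulled back along a map. -/
noncomputable def SetPartition.comap (e : Fin m → Fin n) (π : SetPartition n) : SetPartition m :=
  setPartitionOf (π.setoid.comap e)

theorem sameBlock_comap {e : Fin m → Fin n} {a b : Fin m} :
    SameBlock (π.comap e) a b ↔ SameBlock π (e a) (e b) :=
  sameBlock_setPartitionOf

theorem mem_NC : π ∈ NC n ↔ NonCrossing (SameBlock π) := by simp [NC]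

theorem comap_mem_NC (hπ : π ∈ NC n) (e : Fin m ↪o Fin n) : π.comap e ∈ NC m := by
  rw [mem_NC] at hπ ⊢
  intro p₁ q₁ p₂ q₂ h₁ h₂ h₃ h₄ h₅
  rw [sameBlock_comap] at *
  exact hπ _ _ _ _ (e.lt_iff_lt.2 h₁) (e.lt_iff_lt.2 h₂) (e.lt_iff_lt.2 h₃) h₄ h₅

theorem inf_mem_NC (hσ : σ ∈ NC n) (hτ : τ ∈ NC n) : σ ⊓ τ ∈ NC n := by
  rw [mem_NC] at *
  intro p₁ q₁ p₂ q₂ h₁ h₂ h₃ h₄ h₅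
  rw [sameBlock_inf] at *
  exact ⟨hσ _ _ _ _ h₁ h₂ h₃ h₄.1 h₅.1, hτ _ _ _ _ h₁ h₂ h₃ h₄.2 h₅.2⟩

/-! ### Order properties and injectivity of the Kreweras complement -/

theorem kreweras_mem_NC (hπ : π ∈ NC n) : kreweras π ∈ NC n := (kreweras_isGreatest hπ).1.1

theorem kreweras_anti : Antitone (kreweras (n := n)) := by
  intro π σ h
  rw [SetPartition.le_iff] at h ⊢
  intro i j hij
  rw [sameBlock_kreweras] at hij ⊢
  exact fun a b hab => hij a b (h a b hab)

theorem exists_greatest {P : Fin n → Prop} (h : ∃ x, P x) : ∃ x, P x ∧ ∀ y, P y → y ≤ x := by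
  classical
  obtain ⟨x, hx⟩ := h
  obtain ⟨y, hy, hmax⟩ := (Finset.univ.filter P).exists_max_image id ⟨x, by simpa using hx⟩
  exact ⟨y, by simpa using hy, fun z hz => hmax z (by simpa using hz)⟩

theorem exists_least {P : Fin n → Prop} (h : ∃ x, P x) : ∃ x, P x ∧ ∀ y, P y → x ≤ y := by
  classical
  obtain ⟨x, hx⟩ := h
  obtain ⟨y, hy, hmin⟩ := (Finset.univ.filter P).exists_min_image id ⟨x, by simpa using hx⟩
  exact ⟨y, by simpa using hy, fun z hz => hmin z (by simpa using hz)⟩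

/-- Two points of a block of a non-crossing partition do not separate two points of another. -/
theorem separation_iff_of_mem_NC (hσ : σ ∈ NC n) {a b : Fin n} (hij : SameBlock σ i j)
    (hab : SameBlock σ a b) (hia : ¬ SameBlock σ i a) :
    (a ≤ i ↔ a ≤ j) ↔ (b ≤ i ↔ b ≤ j) := by
  rw [mem_NC] at hσ
  have hib : ¬ SameBlock σ i b := fun h => hia (h.trans hab.symm)
  have hja : ¬ SameBlock σ j a := fun h => hia (hij.trans h)
  have hjb : ¬ SameBlock σ j b := fun h => hib (hij.trans h)
  have nia : a ≠ i := fun h => hia (h ▸ SameBlock.refl σ i)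
  have nja : a ≠ j := fun h => hja (h ▸ SameBlock.refl σ j)
  have nib : b ≠ i := fun h => hib (h ▸ SameBlock.refl σ i)
  have njb : b ≠ j := fun h => hjb (h ▸ SameBlock.refl σ j)
  -- Each `hᵢ` below rules out one alternating order of the four points; the remaining orders
  -- satisfy the claim.
  have key : ∀ x y u v, SameBlock σ x y → SameBlock σ u v → ¬ SameBlock σ y u →
      x < u → u < y → y < v → False :=
    fun x y u v h₁ h₂ h₃ l₁ l₂ l₃ => h₃ (hσ x u y v l₁ l₂ l₃ h₁ h₂)
  have h₁ := key i j a b hij hab hja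
  have h₂ := key i j b a hij hab.symm hjb
  have h₃ := key j i a b hij.symm hab hia
  have h₄ := key j i b a hij.symm hab.symm hib
  have h₅ := key a b i j hab hij (fun h => hib h.symm)
  have h₆ := key a b j i hab hij.symm (fun h => hjb h.symm)
  have h₇ := key b a i j hab.symm hij (fun h => hia h.symm)
  have h₈ := key b a j i hab.symm hij.symm (fun h => hja h.symm)
  clear key
  rcases lt_trichotomy i j with h | h | h
  · rcases lt_or_gt_of_ne nia with h' | h' <;> rcases lt_or_gt_of_ne nja with h'' | h'' <;>
    rcases lt_or_gt_of_ne nib with k' | k' <;> rcases lt_or_gt_of_ne njb with k'' | k'' <;> grind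
  · subst h; simp
  · rcases lt_or_gt_of_ne nia with h' | h' <;> rcases lt_or_gt_of_ne nja with h'' | h'' <;>
    rcases lt_or_gt_of_ne nib with k' | k' <;> rcases lt_or_gt_of_ne njb with k'' | k'' <;> grind

/-- If a block of `σ` had points both inside and outside `(i, j]`, two of its points, one on each
side, would be adjacent enough to be joined by `K(π)`. They would then be joined by `σ ⊓ K(π)` and
separated by `(i, j]`, which membership in `K(σ ⊓ K(π))` forbids. -/
theorem kreweras_inf_kreweras (hσ : σ ∈ NC n) (h : π ≤ σ) :
    kreweras (σ ⊓ kreweras π) ⊓ kreweras π = kreweras σ := by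
  refine le_antisymm ?_ (le_inf (kreweras_anti inf_le_left) (kreweras_anti h))
  have hπσ := SetPartition.le_iff.1 h
  have main : ∀ i j, i < j → SameBlock (kreweras (σ ⊓ kreweras π) ⊓ kreweras π) i j →
      ∀ a b, SameBlock σ a b → i < a → a ≤ j → i < b ∧ b ≤ j := by
    intro i j hij hk a b hab hia haj
    obtain ⟨h₁, h₂⟩ := sameBlock_inf.1 hk
    rw [sameBlock_kreweras] at h₁ h₂
    by_contra hb
    obtain ⟨d, ⟨had, hid, hdj⟩, hd⟩ := exists_greatest
      (P := fun x => SameBlock σ a x ∧ i < x ∧ x ≤ j) ⟨a, SameBlock.refl σ a, hia, haj⟩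
    -- `d` is the witness inside `(i, j]`. It remains to find a point `p` of the same `σ`-block
    -- outside `(i, j]` with `p` and `d` joined by `K(π)`.
    have fin : ∀ p, SameBlock σ a p → ¬ (i < p ∧ p ≤ j) → ¬ SameBlock (kreweras π) p d := by
      intro p hap hp hpd
      have := h₁ p d (sameBlock_inf.2 ⟨hap.symm.trans had, hpd⟩)
      grind
    by_cases hlow : ∃ x, SameBlock σ a x ∧ x ≤ i
    · obtain ⟨p, ⟨hap, hpi⟩, hp⟩ := exists_greatest hlow
      refine fin p hap (by grind) ?_
      rw [sameBlock_kreweras]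
      intro x y hxy
      -- On the `σ`-block of `a`, the points of `(p, d]` are those of `(i, j]`, which no block of
      -- `π` straddles by `h₂`; other `σ`-blocks are not separated by `p` and `d`.
      by_cases hax : SameBlock σ a x
      · have hay := hax.trans (hπσ _ _ hxy)
        have := h₂ x y hxy
        have := hd x; have := hd y; have := hp x; have := hp y
        grind
      · exact separation_iff_of_mem_NC hσ (hap.symm.trans had) (hπσ _ _ hxy)
          fun h => hax (hap.trans h)
    -- With no point of the block at or below `i`, the last point of the block serves: `(d, p]` then
    -- meets the block in the complement of `(i, j]`.
    · obtain ⟨p, hap, hp⟩ := exists_greatest (P := fun x => SameBlock σ a x) ⟨b, hab⟩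
      have hbp := hp b hab
      refine fin p hap (by grind) ?_
      rw [sameBlock_kreweras]
      intro x y hxy
      by_cases hax : SameBlock σ a x
      · have hay := hax.trans (hπσ _ _ hxy)
        have := h₂ x y hxy
        have := hd x; have := hd y; have := hp x; have := hp y
        grind
      · exact separation_iff_of_mem_NC hσ (hap.symm.trans had) (hπσ _ _ hxy)
          fun h => hax (hap.trans h)
  rw [SetPartition.le_iff]
  intro i j hij
  rw [sameBlock_kreweras]
  intro a b hab
  rcases lt_trichotomy i j with h' | h' | h'
  · have := main i j h' hij a b hab
    have := main i j h' hij b a hab.symm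
    grind
  · subst h'; simp
  · have := main j i h' hij.symm a b hab
    have := main j i h' hij.symm b a hab.symm
    grind

/-- A non-crossing partition is recovered from its Kreweras complement. -/
theorem sameBlock_iff_kreweras (hπ : π ∈ NC n) : SameBlock π i j ↔
    ∀ a b, SameBlock (kreweras π) a b → ((a < i ↔ a < j) ↔ (b < i ↔ b < j)) := by
  constructor
  · intro h a b hab
    rw [sameBlock_kreweras] at hab
    have := hab i j h
    grind
  have hNC := mem_NC.1 hπ
  have main : ∀ i j, i < j → (∀ a b, SameBlock (kreweras π) a b →
      ((a < i ↔ a < j) ↔ (b < i ↔ b < j))) → SameBlock π i j := by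
    intro i j hij h
    by_contra hnot
    obtain ⟨p, ⟨hip, hpj⟩, hp⟩ := exists_greatest
      (P := fun x => SameBlock π i x ∧ x < j) ⟨i, SameBlock.refl π i, hij⟩
    have hip' := hp i ⟨SameBlock.refl π i, hij⟩
    -- Here `i ≤ p < j`, so the contradiction comes from any `b` outside `[i, j)` joined to `p` by
    -- `K(π)`. Such a `b` is the predecessor of the cyclic successor of `p` in its block.
    have fin : ∀ b, ((b < i ∧ b < j) ∨ (i ≤ b ∧ j ≤ b)) → ¬ SameBlock (kreweras π) p b := by
      intro b hb hpb
      have := h p b hpb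
      grind
    by_cases hup : ∃ x, SameBlock π i x ∧ j < x
    · obtain ⟨q, ⟨hiq, hjq⟩, hq⟩ := exists_least hup
      obtain ⟨b, hbq, hb⟩ := exists_greatest (P := fun x => x < q) ⟨j, hjq⟩
      have hjb := hb j hjq
      refine fin b (by grind) ?_
      rw [sameBlock_kreweras]
      have key : ∀ x y, SameBlock π x y → p < x → x ≤ b → p < y ∧ y ≤ b := by
        intro x y hxy hpx hxb
        have hix : ¬ SameBlock π i x := by
          intro hix
          have := hp x; have := hq x
          grind
        have hiy : ¬ SameBlock π i y := fun hiy => hix (hiy.trans hxy.symm)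
        have := separation_iff_of_mem_NC hπ (hip.symm.trans hiq) hxy (fun h => hix (hip.trans h))
        have : y ≠ p := fun h => hiy (h ▸ hip)
        have : y ≠ q := fun h => hiy (h ▸ hiq)
        have : x ≠ q := fun h => hix (h ▸ hiq)
        have := hb y
        grind
      intro x y hxy
      have := key x y hxy
      have := key y x hxy.symm
      grind
    · have hpmax : ∀ x, SameBlock π i x → x ≤ p := by
        intro x hx
        have : x ≠ j := fun h => hnot (h ▸ hx)
        have := hp x
        grind
      obtain ⟨m, him, hm⟩ := exists_least (P := fun x => SameBlock π i x) ⟨i, SameBlock.refl π i⟩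
      have hmi := hm i (SameBlock.refl π i)
      -- The hull `[m, p]` of the block is a union of blocks of `π`, so `K(π)` joins `p` to the
      -- point cyclically preceding `m`.
      have key : ∀ x y, SameBlock π x y → m ≤ x → x ≤ p → m ≤ y ∧ y ≤ p := by
        intro x y hxy hmx hxp
        by_cases hix : SameBlock π i x
        · exact ⟨hm y (hix.trans hxy), hpmax y (hix.trans hxy)⟩
        have hiy : ¬ SameBlock π i y := fun hiy => hix (hiy.trans hxy.symm)
        have := separation_iff_of_mem_NC hπ (him.symm.trans hip) hxy (fun h => hix (him.trans h))
        have : y ≠ p := fun h => hiy (h ▸ hip)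
        have : y ≠ m := fun h => hiy (h ▸ him)
        have : x ≠ m := fun h => hix (h ▸ him)
        grind
      by_cases hlow : ∃ x, x < m
      · obtain ⟨b, hbm, hb⟩ := exists_greatest hlow
        refine fin b (by grind) ?_
        rw [sameBlock_kreweras]
        intro x y hxy
        have := key x y hxy
        have := key y x hxy.symm
        have := hb x; have := hb y
        grind
      · obtain ⟨b, -, hb⟩ := exists_greatest (P := fun _ : Fin n => True) ⟨i, trivial⟩
        have := hb i trivial
        have := hb j trivial
        refine fin b (by grind) ?_
        rw [sameBlock_kreweras]
        intro x y hxy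
        have := key x y hxy
        have := key y x hxy.symm
        have := hb x trivial; have := hb y trivial
        have : m ≤ x := not_lt.1 fun h => hlow ⟨x, h⟩
        have : m ≤ y := not_lt.1 fun h => hlow ⟨y, h⟩
        grind
  intro h
  rcases lt_trichotomy i j with h' | h' | h'
  · exact main i j h' h
  · exact h' ▸ SameBlock.refl π i
  · refine (main j i h' fun a b hab => ?_).symm
    have := h a b hab
    grind

theorem kreweras_injOn : Set.InjOn (kreweras (n := n)) (NC n) := by
  intro π hπ σ hσ h
  refine SetPartition.ext fun i j => ?_
  rw [sameBlock_iff_kreweras hπ, sameBlock_iff_kreweras hσ, h]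

/-- The Kreweras complement inside a block `V` of `σ`. -/
theorem comap_inf_kreweras (hσ : σ ∈ NC n) (h : π ≤ σ) {V : Finset (Fin n)} (hV : V ∈ σ.parts)
    (e : Fin m ↪o Fin n) (he : Set.range e = V) :
    (σ ⊓ kreweras π).comap e = kreweras (π.comap e) := by
  have hmem : ∀ a, e a ∈ V := fun a => by rw [← Finset.mem_coe, ← he]; exact ⟨a, rfl⟩
  refine SetPartition.ext fun i j => ?_
  rw [sameBlock_comap, sameBlock_inf, sameBlock_kreweras, sameBlock_kreweras]
  constructor
  · rintro ⟨-, h'⟩ a b hab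
    have := h' _ _ (sameBlock_comap.1 hab)
    simpa only [e.le_iff_le] using this
  · intro h'
    have hij : SameBlock σ (e i) (e j) := .of_mem hV (hmem i) (hmem j)
    refine ⟨hij, fun a b hab => ?_⟩
    have hab' := SetPartition.le_iff.1 h a b hab
    -- A block of `π` that misses `V` lies in another block of `σ`, so non-crossingness of `σ` keeps
    -- it from separating points of `V`.
    by_cases ha : a ∈ V
    · have hb : b ∈ V := hab'.mem hV ha
      rw [← Finset.mem_coe, ← he] at ha hb
      obtain ⟨a, rfl⟩ := ha
      obtain ⟨b, rfl⟩ := hb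
      simpa only [e.le_iff_le] using h' a b (sameBlock_comap.2 hab)
    · exact separation_iff_of_mem_NC hσ hij hab' fun h => ha (h.mem hV (hmem i))

/-- A refinement of a non-crossing partition is non-crossing if it is so inside each block. -/
theorem mem_NC_of_le (hσ : σ ∈ NC n) (h : π ≤ σ) {l : Finset (Fin n) → ℕ}
    (e : ∀ V, Fin (l V) ↪o Fin n) (he : ∀ V, Set.range (e V) = V)
    (hπ : ∀ V ∈ σ.parts, π.comap (e V) ∈ NC (l V)) : π ∈ NC n := by
  rw [mem_NC] at hσ ⊢
  have hπσ := SetPartition.le_iff.1 h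
  intro p₁ q₁ p₂ q₂ h₁ h₂ h₃ hp hq
  obtain ⟨V, hV, hp₁, hp₂⟩ := hπσ _ _ hp
  have hq₁ : q₁ ∈ V := (hσ _ _ _ _ h₁ h₂ h₃ (hπσ _ _ hp) (hπσ _ _ hq)).mem hV hp₂
  have hq₂ : q₂ ∈ V := (hπσ _ _ hq).mem hV hq₁
  rw [← Finset.mem_coe, ← he] at hp₁ hp₂ hq₁ hq₂
  obtain ⟨a, rfl⟩ := hp₁
  obtain ⟨b, rfl⟩ := hq₁
  obtain ⟨c, rfl⟩ := hp₂
  obtain ⟨d, rfl⟩ := hq₂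
  have := mem_NC.1 (hπ V hV) a b c d ((e V).lt_iff_lt.1 h₁) ((e V).lt_iff_lt.1 h₂)
    ((e V).lt_iff_lt.1 h₃) (sameBlock_comap.2 hp) (sameBlock_comap.2 hq)
  exact sameBlock_comap.1 this

end SetPartition

/-! ### Blocks of words -/

section Words

variable {n : ℕ} {π σ : SetPartition n}

theorem mem_parts_iff {B : Finset (Fin n)} : B ∈ π.parts ↔ ∃ i, ∀ x, x ∈ B ↔ SameBlock π i x := by
  constructor
  · intro hB
    obtain ⟨i, hi⟩ := π.nonempty_of_mem_parts hB
    exact ⟨i, fun x => ⟨fun hx => .of_mem hB hi hx, fun hx => hx.mem hB hi⟩⟩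
  · rintro ⟨i, h⟩
    obtain ⟨V, hV, hi, -⟩ := SameBlock.refl π i
    have : B = V := by
      ext x
      exact (h x).trans ⟨fun hx => hx.mem hV hi, fun hx => .of_mem hV hi hx⟩
    exact this ▸ hV

variable {s : ℕ} {R : Type*} [CommRing R]

theorem length_restrictWord (w : List (Fin s)) (V : Finset (Fin w.length)) :
    (restrictWord w V).length = V.card := by simp [restrictWord]

/-- The positions of the letters of `w|V` in `w`. -/
def blockEmb (w : List (Fin s)) (V : Finset (Fin w.length)) :
    Fin (restrictWord w V).length ↪o Fin w.length :=
  V.orderEmbOfFin (length_restrictWord w V).symm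

theorem range_blockEmb (w : List (Fin s)) (V : Finset (Fin w.length)) :
    Set.range (blockEmb w V) = V := Finset.range_orderEmbOfFin _ _

theorem blockEmb_mem {w : List (Fin s)} {V : Finset (Fin w.length)} (i) : blockEmb w V i ∈ V :=
  Finset.orderEmbOfFin_mem _ _ _

theorem exists_blockEmb {w : List (Fin s)} {V : Finset (Fin w.length)} {x : Fin w.length}
    (hx : x ∈ V) : ∃ i, blockEmb w V i = x := by
  rwa [← Finset.mem_coe, ← range_blockEmb] at hx

theorem get_restrictWord (w : List (Fin s)) (V : Finset (Fin w.length)) (i) :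
    (restrictWord w V).get i = w.get (blockEmb w V i) := by
  exact List.getElem_map (l := V.sort (· ≤ ·)) (i := i) w.get

theorem restrictWord_of_emb {u w : List (Fin s)} (e : Fin u.length ↪o Fin w.length)
    (he : ∀ i, u.get i = w.get (e i)) (B : Finset (Fin u.length)) :
    restrictWord u B = restrictWord w (B.map e.toEmbedding) := by
  unfold restrictWord
  rw [← Finset.map_sort e.toEmbedding B (· ≤ ·) (· ≤ ·) fun a _ b _ => (e.le_iff_le).symm,
    List.map_map]
  exact List.map_congr_left fun i _ => he i

theorem restrictWord_univ (w : List (Fin s)) : restrictWord w Finset.univ = w := by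
  rw [restrictWord, Fin.sort_univ, ← List.ofFn_eq_map]
  exact List.ofFn_get w

theorem restrictWord_ne_nil {w : List (Fin s)} {V : Finset (Fin w.length)} (hV : V.Nonempty) :
    restrictWord w V ≠ [] := by
  rw [← List.length_pos_iff, length_restrictWord]
  exact hV.card_pos

/-! ### Factorization over blocks and associativity -/

/-- Each block of `π` lies in exactly one block of `σ`, and restricting a word in two stages gives
the same subword. -/
theorem coeffPart_eq_prod (f : MSeries s R) (w : List (Fin s)) {π σ : SetPartition w.length}
    (h : π ≤ σ) : coeffPart f w π =
      ∏ V ∈ σ.parts, coeffPart f (restrictWord w V) (π.comap (blockEmb w V)) := by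
  classical
  have hsub := SetPartition.le_iff.1 h
  have hU : π.parts = σ.parts.biUnion fun V => π.parts.filter (· ⊆ V) := by
    ext B
    simp only [Finset.mem_biUnion, Finset.mem_filter]
    constructor
    · intro hB
      obtain ⟨V, hV, hBV⟩ := h hB
      exact ⟨V, hV, hB, hBV⟩
    · rintro ⟨V, -, hB, -⟩
      exact hB
  rw [coeffPart, hU, Finset.prod_biUnion]
  · refine Finset.prod_congr rfl fun V hV => (Finset.prod_bij
      (fun B _ => B.map (blockEmb w V).toEmbedding) ?_ ?_ ?_ ?_).symm
    · intro B hB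
      rw [Finset.mem_filter, mem_parts_iff]
      obtain ⟨i, hi⟩ := mem_parts_iff.1 hB
      refine ⟨⟨blockEmb w V i, fun x => ?_⟩, fun x hx => ?_⟩
      · simp only [Finset.mem_map, RelEmbedding.coe_toEmbedding]
        constructor
        · rintro ⟨j, hj, rfl⟩
          exact sameBlock_comap.1 ((hi j).1 hj)
        · intro hx
          obtain ⟨j, rfl⟩ := exists_blockEmb ((hsub _ _ hx).mem hV (blockEmb_mem i))
          exact ⟨j, (hi j).2 (sameBlock_comap.2 hx), rfl⟩
      · obtain ⟨j, -, rfl⟩ := Finset.mem_map.1 hx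
        exact blockEmb_mem j
    · intro B _ B' _ hBB'
      exact Finset.map_injective _ hBB'
    · intro B hB
      obtain ⟨hB, hBV⟩ := Finset.mem_filter.1 hB
      obtain ⟨i, hi⟩ := mem_parts_iff.1 hB
      obtain ⟨i, rfl⟩ := exists_blockEmb (hBV ((hi i).2 (SameBlock.refl π i)))
      refine ⟨Finset.univ.filter fun j => blockEmb w V j ∈ B,
        mem_parts_iff.2 ⟨i, fun j => ?_⟩, ?_⟩
      · rw [sameBlock_comap, ← hi]
        simp
      · ext x
        simp only [Finset.mem_map, RelEmbedding.coe_toEmbedding, Finset.mem_filter,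
          Finset.mem_univ, true_and]
        constructor
        · rintro ⟨j, hj, rfl⟩
          exact hj
        · intro hx
          obtain ⟨j, rfl⟩ := exists_blockEmb (hBV hx)
          exact ⟨j, hx, rfl⟩
    · intro B _
      rw [restrictWord_of_emb (blockEmb w V) (get_restrictWord w V)]
  · intro V hV W hW hVW
    rw [Function.onFun, Finset.disjoint_left]
    intro B hB hB'
    obtain ⟨hB, hBV⟩ := Finset.mem_filter.1 hB
    obtain ⟨-, hBW⟩ := Finset.mem_filter.1 hB'
    obtain ⟨i, hi⟩ := π.nonempty_of_mem_parts hB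
    exact hVW (σ.eq_of_mem_parts hV hW (hBV hi) (hBW hi))

/-- Partitions of the blocks of `σ` glue to a partition finer than `σ`. -/
theorem exists_glue (w : List (Fin s)) (σ : SetPartition w.length)
    (p : ∀ V ∈ σ.parts, SetPartition (restrictWord w V).length) :
    ∃ π ≤ σ, ∀ V hV, π.comap (blockEmb w V) = p V hV := by
  let r : Setoid (Fin w.length) :=
    { r := fun x y => ∃ V, ∃ hV : V ∈ σ.parts, ∃ i j, blockEmb w V i = x ∧ blockEmb w V j = y ∧
        SameBlock (p V hV) i j
      iseqv :=
        { refl := fun x => by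
            obtain ⟨V, hV, hx, -⟩ := SameBlock.refl σ x
            obtain ⟨i, rfl⟩ := exists_blockEmb hx
            exact ⟨V, hV, i, i, rfl, rfl, .refl _ _⟩
          symm := by
            rintro x y ⟨V, hV, i, j, hi, hj, h⟩
            exact ⟨V, hV, j, i, hj, hi, h.symm⟩
          trans := by
            rintro x y z ⟨V, hV, i, j, hi, hj, h⟩ ⟨W, hW, k, l, hk, hl, h'⟩
            obtain rfl : V = W := σ.eq_of_mem_parts hV hW (hj ▸ blockEmb_mem j)
              (hk ▸ blockEmb_mem k)
            obtain rfl : j = k := (blockEmb w V).injective (hj.trans hk.symm)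
            exact ⟨V, hV, i, l, hi, hl, h.trans h'⟩ } }
  refine ⟨setPartitionOf r, SetPartition.le_iff.2 fun x y h => ?_, fun V hV =>
    SetPartition.ext fun a b => ?_⟩
  · obtain ⟨V, hV, i, j, rfl, rfl, -⟩ := sameBlock_setPartitionOf.1 h
    exact .of_mem hV (blockEmb_mem i) (blockEmb_mem j)
  · rw [sameBlock_comap, sameBlock_setPartitionOf]
    constructor
    · rintro ⟨W, hW, i, j, hi, hj, h⟩
      obtain rfl : V = W := σ.eq_of_mem_parts hV hW (blockEmb_mem a) (hi ▸ blockEmb_mem i)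
      rwa [(blockEmb w V).injective hi, (blockEmb w V).injective hj] at h
    · exact fun h => ⟨V, hV, a, b, rfl, rfl, h⟩

theorem eq_of_comap_eq {w : List (Fin s)} {π π' σ : SetPartition w.length} (h : π ≤ σ)
    (h' : π' ≤ σ) (hc : ∀ V ∈ σ.parts, π.comap (blockEmb w V) = π'.comap (blockEmb w V)) :
    π = π' := by
  have aux : ∀ {π π' : SetPartition w.length}, π ≤ σ →
      (∀ V ∈ σ.parts, π.comap (blockEmb w V) = π'.comap (blockEmb w V)) →
      ∀ x y, SameBlock π x y → SameBlock π' x y := by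
    intro π π' h hc x y hxy
    obtain ⟨V, hV, hx, hy⟩ := SetPartition.le_iff.1 h x y hxy
    obtain ⟨i, rfl⟩ := exists_blockEmb hx
    obtain ⟨j, rfl⟩ := exists_blockEmb hy
    rw [← sameBlock_comap, hc V hV, sameBlock_comap] at hxy
    exact hxy
  exact SetPartition.ext fun x y => ⟨aux h hc x y, aux h' (fun V hV => (hc V hV).symm) x y⟩

theorem coeffAt_of_ne_nil (f : MSeries s R) {w : List (Fin s)} (h : w ≠ []) :
    coeffAt f w = f ⟨w, h⟩ := dif_pos h

-- Expanding the product of sums chooses a non-crossing partition in every block of `σ`. Such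
-- choices glue to exactly one non-crossing `π ≤ σ`, and their complements glue to `σ ⊓ kreweras π`.
open Classical in
theorem coeffPart_boxConv (f g : MSeries s R) (w : List (Fin s)) {σ : SetPartition w.length}
    (hσ : σ ∈ NC w.length) : coeffPart (boxConv f g) w σ =
      ∑ π ∈ (NC w.length).filter (· ≤ σ), coeffPart f w π * coeffPart g w (σ ⊓ kreweras π) := by
  have h₁ : coeffPart (boxConv f g) w σ = ∏ V ∈ σ.parts, ∑ p ∈ NC (restrictWord w V).length,
      coeffPart f (restrictWord w V) p * coeffPart g (restrictWord w V) (kreweras p) :=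
    Finset.prod_congr rfl fun V hV =>
      coeffAt_of_ne_nil _ (restrictWord_ne_nil (σ.nonempty_of_mem_parts hV))
  rw [h₁, Finset.prod_sum]
  refine (Finset.sum_bij (fun π _ V _ => π.comap (blockEmb w V)) ?_ ?_ ?_ ?_).symm
  · intro π hπ
    exact Finset.mem_pi.2 fun V _ => comap_mem_NC (Finset.mem_filter.1 hπ).1 _
  · intro π hπ π' hπ' h
    exact eq_of_comap_eq (Finset.mem_filter.1 hπ).2 (Finset.mem_filter.1 hπ').2
      fun V hV => congrFun (congrFun h V) hV
  · intro p hp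
    obtain ⟨π, hπ, h⟩ := exists_glue w σ p
    refine ⟨π, Finset.mem_filter.2 ⟨?_, hπ⟩, funext fun V => funext fun hV => h V hV⟩
    refine mem_NC_of_le hσ hπ (blockEmb w) (range_blockEmb w) fun V hV => ?_
    rw [h V hV]
    exact Finset.mem_pi.1 hp V hV
  · intro π hπ
    have hle := (Finset.mem_filter.1 hπ).2
    rw [coeffPart_eq_prod f w hle, coeffPart_eq_prod g w inf_le_left, ← Finset.prod_mul_distrib,
      ← Finset.prod_attach]
    exact Finset.prod_congr rfl fun V _ => by
      rw [comap_inf_kreweras hσ hle V.2 _ (range_blockEmb w V)]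

theorem boxConv_assoc (f g h : MSeries s R) :
    boxConv (boxConv f g) h = boxConv f (boxConv g h) := by
  classical
  funext ⟨w, hw⟩
  have h₁ : boxConv (boxConv f g) h ⟨w, hw⟩ =
      ∑ x ∈ (NC w.length).sigma fun σ => (NC w.length).filter (· ≤ σ),
        coeffPart f w x.2 * coeffPart g w (x.1 ⊓ kreweras x.2) * coeffPart h w (kreweras x.1) := by
    rw [Finset.sum_sigma]
    refine Finset.sum_congr rfl fun σ hσ => ?_
    rw [coeffPart_boxConv f g w hσ, Finset.sum_mul]
  have h₂ : boxConv f (boxConv g h) ⟨w, hw⟩ =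
      ∑ x ∈ (NC w.length).sigma fun π => (NC w.length).filter (· ≤ kreweras π),
        coeffPart f w x.1 * coeffPart g w x.2 *
          coeffPart h w (kreweras x.1 ⊓ kreweras x.2) := by
    rw [Finset.sum_sigma]
    refine Finset.sum_congr rfl fun π hπ => ?_
    rw [coeffPart_boxConv g h w (kreweras_mem_NC hπ), Finset.mul_sum]
    simp only [mul_assoc]
  rw [h₁, h₂]
  let φ : (Σ _ : SetPartition w.length, SetPartition w.length) →
      Σ _ : SetPartition w.length, SetPartition w.length := fun x => ⟨x.2, x.1 ⊓ kreweras x.2⟩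
  have hφ : ∀ x ∈ (NC w.length).sigma fun σ => (NC w.length).filter (· ≤ σ),
      φ x ∈ (NC w.length).sigma fun π => (NC w.length).filter (· ≤ kreweras π) := by
    rintro ⟨σ, π⟩ hx
    simp only [Finset.mem_sigma, Finset.mem_filter, φ] at hx ⊢
    exact ⟨hx.2.1, inf_mem_NC hx.1 (kreweras_mem_NC hx.2.1), inf_le_right⟩
  have hinj : ∀ x ∈ (NC w.length).sigma fun σ => (NC w.length).filter (· ≤ σ),
      ∀ y ∈ (NC w.length).sigma fun σ => (NC w.length).filter (· ≤ σ), φ x = φ y → x = y := by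
    rintro ⟨σ, π⟩ hx ⟨σ', π'⟩ hy hxy
    simp only [Finset.mem_sigma, Finset.mem_filter] at hx hy
    simp only [φ, Sigma.mk.injEq, heq_eq_eq] at hxy
    obtain ⟨rfl, hxy⟩ := hxy
    obtain rfl : σ = σ' := kreweras_injOn hx.1 hy.1 (by
      rw [← kreweras_inf_kreweras hx.1 hx.2.2, hxy, kreweras_inf_kreweras hy.1 hy.2.2])
    rfl
  -- Surjectivity of `φ` is obtained by counting: `(π, τ) ↦ (K(π), τ)` injects the target back into
  -- the source.
  have hcard : ((NC w.length).sigma fun π => (NC w.length).filter (· ≤ kreweras π)).card ≤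
      ((NC w.length).sigma fun σ => (NC w.length).filter (· ≤ σ)).card := by
    refine Finset.card_le_card_of_injOn (fun x => ⟨kreweras x.1, x.2⟩) ?_ ?_
    · rintro ⟨π, τ⟩ hx
      simp only [Finset.coe_sigma, Set.mem_sigma_iff, Finset.mem_coe, Finset.mem_filter] at hx ⊢
      exact ⟨kreweras_mem_NC hx.1, hx.2⟩
    · rintro ⟨π, τ⟩ hx ⟨π', τ'⟩ hy hxy
      simp only [Finset.coe_sigma, Set.mem_sigma_iff, Finset.mem_coe, Finset.mem_filter] at hx hy
      simp only [Sigma.mk.injEq, heq_eq_eq] at hxy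
      obtain ⟨h, rfl⟩ := hxy
      rw [kreweras_injOn hx.1 hy.1 h]
  refine Finset.sum_bij (fun x _ => φ x) hφ (fun x hx y hy => hinj x hx y hy) (fun y hy => ?_) ?_
  · obtain ⟨x, hx, h⟩ := Finset.surj_on_of_inj_on_of_card_le (fun x _ => φ x) hφ
      (fun x y hx hy => hinj x hx y hy) hcard y hy
    exact ⟨x, hx, h.symm⟩
  · rintro ⟨σ, π⟩ hx
    simp only [Finset.mem_sigma, Finset.mem_filter] at hx
    simp only [φ]
    rw [inf_comm (kreweras π), kreweras_inf_kreweras hx.1 hx.2.2]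

end Words

/-! ### The monoid of series under boxed convolution -/

section Monoid

variable {n : ℕ} {π σ : SetPartition n} {i j : Fin n}

theorem sameBlock_bot : SameBlock (⊥ : SetPartition n) i j ↔ i = j := by
  constructor
  · rintro ⟨V, hV, hi, hj⟩
    obtain ⟨a, -, rfl⟩ := Finpartition.mem_bot_iff.1 hV
    rw [Finset.mem_singleton] at hi hj
    rw [hi, hj]
  · rintro rfl
    exact .refl _ _

/-- The partition with a single block. -/
noncomputable def fullPartition (n : ℕ) : SetPartition n := setPartitionOf ⊤

theorem sameBlock_full : SameBlock (fullPartition n) i j := sameBlock_setPartitionOf.2 trivial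

theorem full_mem_NC : fullPartition n ∈ NC n :=
  mem_NC.2 fun _ _ _ _ _ _ _ _ _ => sameBlock_full

theorem bot_mem_NC : (⊥ : SetPartition n) ∈ NC n := by
  rw [mem_NC]
  intro p₁ q₁ p₂ q₂ h₁ h₂ h₃ h₄
  exact absurd (sameBlock_bot.1 h₄) (h₁.trans h₂).ne

theorem kreweras_bot : kreweras (⊥ : SetPartition n) = fullPartition n := by
  refine SetPartition.ext fun i j => ⟨fun _ => sameBlock_full, fun _ => ?_⟩
  rw [sameBlock_kreweras]
  intro a b hab
  rw [sameBlock_bot.1 hab]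

theorem kreweras_full : kreweras (fullPartition n) = ⊥ := by
  refine SetPartition.ext fun i j => ⟨fun h => ?_, fun h => sameBlock_bot.1 h ▸ .refl _ _⟩
  rw [sameBlock_kreweras] at h
  have := h i j sameBlock_full
  rw [sameBlock_bot]
  grind

theorem eq_full_of_univ_mem (h : Finset.univ ∈ π.parts) : π = fullPartition n :=
  SetPartition.ext fun i j =>
    ⟨fun _ => sameBlock_full, fun _ => .of_mem h (Finset.mem_univ i) (Finset.mem_univ j)⟩

variable {s : ℕ} {R : Type*} [CommRing R]

theorem coeffPart_full (f : MSeries s R) {w : List (Fin s)} (hw : w ≠ []) :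
    coeffPart f w (fullPartition w.length) = f ⟨w, hw⟩ := by
  have : (fullPartition w.length).parts = {Finset.univ} := by
    ext B
    rw [mem_parts_iff, Finset.mem_singleton]
    constructor
    · rintro ⟨i, hi⟩
      exact Finset.eq_univ_of_forall fun x => (hi x).2 sameBlock_full
    · rintro rfl
      exact ⟨⟨0, List.length_pos_iff.2 hw⟩,
        fun x => ⟨fun _ => sameBlock_full, fun _ => Finset.mem_univ x⟩⟩
  rw [coeffPart, this, Finset.prod_singleton, restrictWord_univ, coeffAt_of_ne_nil _ hw]

theorem restrictWord_singleton (w : List (Fin s)) (a : Fin w.length) :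
    restrictWord w {a} = [w.get a] := by simp [restrictWord]

theorem coeffAt_boxUnit (w : List (Fin s)) :
    coeffAt (boxUnit s R) w = if w.length = 1 then 1 else 0 := by
  by_cases h : w = []
  · simp [coeffAt, h]
  · rw [coeffAt_of_ne_nil _ h, boxUnit]

theorem coeffPart_boxUnit_bot (w : List (Fin s)) : coeffPart (boxUnit s R) w ⊥ = 1 := by
  refine Finset.prod_eq_one fun V hV => ?_
  obtain ⟨a, -, rfl⟩ := Finpartition.mem_bot_iff.1 hV
  rw [restrictWord_singleton, coeffAt_boxUnit, List.length_singleton, if_pos rfl]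

theorem coeffPart_boxUnit_of_ne {w : List (Fin s)} {π : SetPartition w.length} (h : π ≠ ⊥) :
    coeffPart (boxUnit s R) w π = 0 := by
  by_contra h0
  refine h (le_bot_iff.1 (SetPartition.le_iff.2 ?_))
  rintro i j ⟨V, hV, hi, hj⟩
  have hc : V.card = 1 := by
    by_contra hc
    refine h0 (Finset.prod_eq_zero hV ?_)
    rw [coeffAt_boxUnit, length_restrictWord, if_neg hc]
  exact sameBlock_bot.2 (Finset.card_le_one.1 hc.le i hi j hj)

theorem boxUnit_boxConv (f : MSeries s R) : boxConv (boxUnit s R) f = f := by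
  funext ⟨w, hw⟩
  rw [boxConv, Finset.sum_eq_single_of_mem ⊥ bot_mem_NC]
  · rw [coeffPart_boxUnit_bot, kreweras_bot, one_mul, coeffPart_full f hw]
  · intro π _ hπ
    rw [coeffPart_boxUnit_of_ne hπ, zero_mul]

theorem boxConv_boxUnit (f : MSeries s R) : boxConv f (boxUnit s R) = f := by
  funext ⟨w, hw⟩
  rw [boxConv, Finset.sum_eq_single_of_mem (fullPartition _) full_mem_NC]
  · rw [kreweras_full, coeffPart_boxUnit_bot, mul_one, coeffPart_full f hw]
  · intro π hπ hne
    rw [coeffPart_boxUnit_of_ne, mul_zero]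
    intro h
    exact hne (kreweras_injOn hπ full_mem_NC (h.trans kreweras_full.symm))

theorem boxConv_singleton (f g : MSeries s R) (i : Fin s) :
    boxConv f g ⟨[i], List.cons_ne_nil i []⟩ =
      f ⟨[i], List.cons_ne_nil i []⟩ * g ⟨[i], List.cons_ne_nil i []⟩ := by
  have hsub : ∀ π : SetPartition [i].length, π = fullPartition _ := fun π =>
    SetPartition.ext fun a b =>
      ⟨fun _ => sameBlock_full, fun _ => (Subsingleton.elim (α := Fin 1) a b) ▸ .refl π a⟩
  rw [boxConv, Finset.sum_eq_single_of_mem (fullPartition _) full_mem_NC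
    fun π _ h => absurd (hsub π) h, hsub (kreweras _), coeffPart_full, coeffPart_full]

/-! ### Inverses by recursion on word length -/

/-- A map on functions whose values depend only on arguments of smaller length has a fixed point. -/
theorem exists_fixedPoint_of_length {α β : Type*} [Nonempty β] (len : α → ℕ)
    (Φ : (α → β) → α → β)
    (hΦ : ∀ f f' a, (∀ b, len b < len a → f b = f' b) → Φ f a = Φ f' a) : ∃ f, Φ f = f := by
  obtain ⟨f₀⟩ : Nonempty (α → β) := inferInstance
  -- The iterates of `Φ` at `a` are constant from step `len a + 1` on, so the stable values form the
  -- fixed point.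
  have key : ∀ l a, len a = l → ∀ n m, len a < n → len a < m → Φ^[n] f₀ a = Φ^[m] f₀ a := by
    intro l
    induction l using Nat.strong_induction_on with
    | _ l ih =>
      rintro a rfl (_ | n) (_ | m) hn hm
      · omega
      · omega
      · omega
      · rw [Function.iterate_succ_apply', Function.iterate_succ_apply']
        exact hΦ _ _ _ fun b hb => ih _ hb b rfl n m (by omega) (by omega)
  refine ⟨fun a => Φ^[len a + 1] f₀ a, funext fun a => ?_⟩
  rw [Function.iterate_succ_apply']
  exact hΦ _ _ _ fun b hb => key _ b rfl _ _ (by omega) hb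

/-- Every block of a partition other than the full one is proper, hence gives a strictly shorter
subword. -/
theorem coeffPart_congr {f f' : MSeries s R} {w : List (Fin s)}
    (h : ∀ v, v.1.length < w.length → f v = f' v) {π : SetPartition w.length}
    (hπ : π ≠ fullPartition _) : coeffPart f w π = coeffPart f' w π := by
  refine Finset.prod_congr rfl fun V hV => ?_
  have hne := restrictWord_ne_nil (π.nonempty_of_mem_parts hV)
  rw [coeffAt_of_ne_nil _ hne, coeffAt_of_ne_nil _ hne]
  apply h
  rw [length_restrictWord]
  by_contra hc
  rw [not_lt] at hc
  have hV' : V = Finset.univ :=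
    Finset.eq_univ_of_card V (le_antisymm (Finset.card_le_univ V) (by simpa using hc))
  exact hπ (eq_full_of_univ_mem (hV' ▸ hV))

theorem isUnit_coeffPart_bot {g : MSeries s R} (hg : g ∈ GSeries s R) (w : List (Fin s)) :
    IsUnit (coeffPart g w ⊥) := by
  refine Finset.prod_induction _ IsUnit (fun _ _ => IsUnit.mul) isUnit_one fun V hV => ?_
  obtain ⟨a, -, rfl⟩ := Finpartition.mem_bot_iff.1 hV
  rw [restrictWord_singleton, coeffAt_of_ne_nil _ (List.cons_ne_nil _ _)]
  exact hg _

/-- In `(f ⊠ g)_w` the full partition contributes `f_w` times a product of degree-one coefficients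
of `g`, a unit; all other terms involve `f` only on shorter words. The equation can thus be solved
for `f_w` recursively. -/
theorem exists_left_inverse {g : MSeries s R} (hg : g ∈ GSeries s R) :
    ∃ f ∈ GSeries s R, boxConv f g = boxUnit s R := by
  classical
  let rest : MSeries s R → MSeries s R := fun f w =>
    ∑ π ∈ (NC w.1.length).erase (fullPartition _),
      coeffPart f w.1 π * coeffPart g w.1 (kreweras π)
  obtain ⟨f, hf⟩ := exists_fixedPoint_of_length (fun w : {w : List (Fin s) // w ≠ []} => w.1.length)
    (fun f w => (boxUnit s R w - rest f w) * Ring.inverse (coeffPart g w.1 ⊥)) (by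
      intro f f' w h
      have : rest f w = rest f' w := Finset.sum_congr rfl fun π hπ => by
        rw [coeffPart_congr h (Finset.mem_erase.1 hπ).1]
      simp only [this])
  have hfg : boxConv f g = boxUnit s R := by
    funext w
    rw [boxConv, ← Finset.add_sum_erase _ _ full_mem_NC, kreweras_full, coeffPart_full f w.2]
    have := congrFun hf w
    rw [Subtype.coe_eta, ← this, mul_assoc,
      Ring.inverse_mul_cancel _ (isUnit_coeffPart_bot hg _), mul_one]
    exact sub_add_cancel _ _
  refine ⟨f, fun i => ?_, hfg⟩
  refine IsUnit.of_mul_eq_one (g ⟨[i], List.cons_ne_nil i []⟩) ?_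
  rw [← boxConv_singleton, hfg, boxUnit, List.length_singleton, if_pos rfl]

theorem boxConv_mem_GSeries {f g : MSeries s R} (hf : f ∈ GSeries s R) (hg : g ∈ GSeries s R) :
    boxConv f g ∈ GSeries s R := fun i => by
  rw [boxConv_singleton]
  exact (hf i).mul (hg i)

theorem boxUnit_mem_GSeries : boxUnit s R ∈ GSeries s R := fun i => by simp [boxUnit]

theorem zeta_mem_GSeries : Zeta s R ∈ GSeries s R := fun _ => isUnit_one

/-- A set closed under an associative operation with left unit and left inverses is a group. -/
theorem isGroupOn_of_left_axioms {M : Type*} {S : Set M} {op : M → M → M} {e : M}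
    (hop : ∀ f ∈ S, ∀ g ∈ S, op f g ∈ S) (he : e ∈ S)
    (assoc : ∀ f ∈ S, ∀ g ∈ S, ∀ h ∈ S, op (op f g) h = op f (op g h))
    (one : ∀ f ∈ S, op e f = f) (inv : ∀ f ∈ S, ∃ g ∈ S, op g f = e) : IsGroupOn S op e := by
  choose! ι hι hinv using inv
  let _ : Mul S := ⟨fun f g => ⟨op f g, hop f f.2 g g.2⟩⟩
  let _ : One S := ⟨⟨e, he⟩⟩
  let _ : Inv S := ⟨fun f => ⟨ι f, hι f f.2⟩⟩
  exact ⟨Group.ofLeftAxioms (fun f g h => Subtype.ext (assoc f f.2 g g.2 h h.2))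
    (fun f => Subtype.ext (one f f.2)) (fun f => Subtype.ext (hinv f f.2)), fun _ _ => rfl, rfl⟩

theorem isGroupOn_boxConv : IsGroupOn (GSeries s R) boxConv (boxUnit s R) :=
  isGroupOn_of_left_axioms (fun _ hf _ hg => boxConv_mem_GSeries hf hg) boxUnit_mem_GSeries
    (fun f _ g _ h _ => boxConv_assoc f g h) (fun f _ => boxUnit_boxConv f)
    fun _ hf => exists_left_inverse hf

theorem exists_isMoebius : ∃ m : MSeries s R, m ∈ GSeries s R ∧ IsMoebius m := by
  obtain ⟨m, hm, h⟩ := exists_left_inverse (zeta_mem_GSeries (s := s) (R := R))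
  -- The left inverse `m` itself has a left inverse, which must be `Zeta`; so `m` is two-sided.
  obtain ⟨m', -, h'⟩ := exists_left_inverse hm
  have : m' = Zeta s R := by
    rw [← boxConv_boxUnit m', ← h, ← boxConv_assoc, h', boxUnit_boxConv]
  exact ⟨m, hm, h, this ▸ h'⟩

theorem isMoebius_moeb : IsMoebius (Moeb s R) :=
  Classical.epsilon_spec (exists_isMoebius.imp fun _ h => h.2)

theorem IsMoebius.unique {m m' : MSeries s R} (h : IsMoebius m) (h' : IsMoebius m') : m = m' := by
  rw [← boxConv_boxUnit m, ← h'.2, ← boxConv_assoc, h.1, boxUnit_boxConv]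

theorem moeb_mem_GSeries : Moeb s R ∈ GSeries s R := by
  obtain ⟨m, hm, h⟩ := exists_isMoebius (s := s) (R := R)
  exact isMoebius_moeb.unique h ▸ hm

/-! ### Transport along right multiplication by `Zeta` -/

theorem boxConv_zeta_moeb (f : MSeries s R) : boxConv (boxConv f (Zeta s R)) (Moeb s R) = f := by
  rw [boxConv_assoc, isMoebius_moeb.2, boxConv_boxUnit]

theorem boxConv_moeb_zeta (f : MSeries s R) : boxConv (boxConv f (Moeb s R)) (Zeta s R) = f := by
  rw [boxConv_assoc, isMoebius_moeb.1, boxConv_boxUnit]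

theorem zeta_boxTimesV (f : MSeries s R) : boxTimesV (Zeta s R) f = f := by
  rw [boxTimesV, isMoebius_moeb.2, boxUnit_boxConv]

theorem boxTimesV_boxConv_zeta (f g : MSeries s R) :
    boxTimesV (boxConv f (Zeta s R)) (boxConv g (Zeta s R)) =
      boxConv (boxConv f g) (Zeta s R) := by
  rw [boxTimesV, boxConv_zeta_moeb, boxConv_assoc]

theorem boxPlusV_boxConv_zeta (f g : MSeries s R) :
    boxPlusV (boxConv f (Zeta s R)) (boxConv g (Zeta s R)) = boxConv (f + g) (Zeta s R) := by
  rw [boxPlusV, boxConv_zeta_moeb, boxConv_zeta_moeb]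

theorem isGroupOn_boxTimesV : IsGroupOn (GSeries s R) boxTimesV (Zeta s R) := by
  refine isGroupOn_of_left_axioms (fun _ hf _ hg => boxConv_mem_GSeries
    (boxConv_mem_GSeries hf moeb_mem_GSeries) hg) zeta_mem_GSeries
    (fun f _ g _ h _ => by simp only [boxTimesV, boxConv_assoc]) (fun f _ => zeta_boxTimesV f)
    fun f hf => ?_
  obtain ⟨g, hg, h⟩ := exists_left_inverse hf
  -- The inverse for `boxTimesV` is `Zeta ⊠ g ⊠ Zeta`, where `g` is the `⊠`-inverse of `f`.
  refine ⟨boxConv (boxConv (Zeta s R) g) (Zeta s R), boxConv_mem_GSeries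
    (boxConv_mem_GSeries zeta_mem_GSeries hg) zeta_mem_GSeries, ?_⟩
  rw [boxTimesV, boxConv_zeta_moeb, boxConv_assoc, h, boxConv_boxUnit]

/-- Words are non-empty, so every partition has a block and each term has a zero factor. This makes
`0` neutral for `boxPlusV`. -/
theorem zero_boxConv (g : MSeries s R) : boxConv 0 g = 0 := by
  funext ⟨w, hw⟩
  refine Finset.sum_eq_zero fun π _ => mul_eq_zero_of_left ?_ _
  obtain ⟨V, hV, -⟩ := SameBlock.refl π ⟨0, List.length_pos_iff.2 hw⟩
  refine Finset.prod_eq_zero hV ?_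
  rw [coeffAt_of_ne_nil _ (restrictWord_ne_nil (π.nonempty_of_mem_parts hV))]
  rfl

theorem isGroupOn_boxPlusV : IsGroupOn (Set.univ : Set (MSeries s R)) boxPlusV 0 := by
  refine isGroupOn_of_left_axioms (fun _ _ _ _ => trivial) trivial
    (fun f _ g _ h _ => by simp only [boxPlusV, boxConv_zeta_moeb, add_assoc])
    (fun f _ => by rw [boxPlusV, zero_boxConv, zero_add, boxConv_moeb_zeta])
    fun f _ => ⟨boxConv (-boxConv f (Moeb s R)) (Zeta s R), trivial, ?_⟩
  rw [boxPlusV, boxConv_zeta_moeb, neg_add_cancel, zero_boxConv]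

theorem isGroupOn_add : IsGroupOn (Set.univ : Set (MSeries s R)) (fun f g => f + g) 0 :=
  isGroupOn_of_left_axioms (fun _ _ _ _ => trivial) trivial (fun f _ g _ h _ => add_assoc f g h)
    (fun f _ => zero_add f) fun f _ => ⟨-f, trivial, neg_add_cancel f⟩

theorem bijOn_boxConv_zeta {S : Set (MSeries s R)} (h : ∀ f ∈ S, boxConv f (Zeta s R) ∈ S)
    (h' : ∀ f ∈ S, boxConv f (Moeb s R) ∈ S) : Set.BijOn (fun f => boxConv f (Zeta s R)) S S :=
  Set.InvOn.bijOn (f' := fun f => boxConv f (Moeb s R))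
    ⟨fun f _ => boxConv_zeta_moeb f, fun f _ => boxConv_moeb_zeta f⟩ h h'

/-! ### Naturality -/

variable {R' : Type*} [CommRing R']

theorem map_coeffPart (φ : R →+* R') (f : MSeries s R) (w : List (Fin s))
    (π : SetPartition w.length) : φ (coeffPart f w π) = coeffPart (f.map φ) w π := by
  rw [coeffPart, map_prod]
  refine Finset.prod_congr rfl fun V hV => ?_
  have hne := restrictWord_ne_nil (π.nonempty_of_mem_parts hV)
  rw [coeffAt_of_ne_nil _ hne, coeffAt_of_ne_nil _ hne, MSeries.map]

theorem map_boxConv (φ : R →+* R') (f g : MSeries s R) :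
    (boxConv f g).map φ = boxConv (f.map φ) (g.map φ) := by
  funext w
  simp only [MSeries.map, boxConv, map_sum, map_mul, map_coeffPart]

theorem map_zeta (φ : R →+* R') : (Zeta s R).map φ = Zeta s R' := funext fun _ => map_one φ

theorem map_boxUnit (φ : R →+* R') : (boxUnit s R).map φ = boxUnit s R' := by
  funext w
  simp [MSeries.map, boxUnit, apply_ite φ]

/-- The image of `Moeb` is a two-sided inverse of `Zeta` over `R'`, and such an inverse is unique.
-/
theorem map_moeb (φ : R →+* R') : (Moeb s R).map φ = Moeb s R' := by
  refine IsMoebius.unique ⟨?_, ?_⟩ isMoebius_moeb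
  · rw [← map_zeta φ, ← map_boxConv, isMoebius_moeb.1, map_boxUnit]
  · rw [← map_zeta φ, ← map_boxConv, isMoebius_moeb.2, map_boxUnit]

theorem MSeries.map_add' (φ : R →+* R') (f g : MSeries s R) :
    (f + g).map φ = f.map φ + g.map φ := funext fun _ => map_add φ _ _

theorem map_boxTimesV (φ : R →+* R') (f g : MSeries s R) :
    (boxTimesV f g).map φ = boxTimesV (f.map φ) (g.map φ) := by
  simp only [boxTimesV, map_boxConv, map_moeb]

theorem map_boxPlusV (φ : R →+* R') (f g : MSeries s R) :
    (boxPlusV f g).map φ = boxPlusV (f.map φ) (g.map φ) := by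
  simp only [boxPlusV, map_boxConv, map_moeb, map_zeta, MSeries.map_add']

end Monoid

/-! ### Commutativity in one variable -/

section OneVariable

variable {n : ℕ} {π : SetPartition n}

theorem comap_rev_mem_NC (hπ : π ∈ NC n) : π.comap Fin.rev ∈ NC n := by
  rw [mem_NC] at hπ ⊢
  intro p₁ q₁ p₂ q₂ h₁ h₂ h₃ h₄ h₅
  rw [sameBlock_comap] at *
  have := hπ _ _ _ _ (Fin.rev_lt_rev.2 h₃) (Fin.rev_lt_rev.2 h₂) (Fin.rev_lt_rev.2 h₁) h₅.symm
    h₄.symm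
  exact this.symm

/-- Recovering `π` from `K(π)` uses the separation criterion that defines `K`, with `<` in place of
`≤`; reversal exchanges the two. -/
theorem kreweras_comap_rev (hπ : π ∈ NC n) :
    kreweras ((kreweras π).comap Fin.rev) = π.comap Fin.rev := by
  refine SetPartition.ext fun i j => ?_
  have e : ∀ a : Fin n, (a.rev ≤ i ↔ a.rev ≤ j) ↔ (a < i.rev ↔ a < j.rev) := fun a => by
    simp only [Fin.le_def, Fin.lt_def, Fin.val_rev]
    omega
  rw [sameBlock_comap, sameBlock_iff_kreweras hπ, sameBlock_kreweras]
  constructor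
  · intro h a b hab
    have := h a.rev b.rev (by rwa [sameBlock_comap, Fin.rev_rev, Fin.rev_rev])
    rwa [e, e] at this
  · intro h a b hab
    have := h _ _ (sameBlock_comap.1 hab)
    rwa [← e, ← e, Fin.rev_rev, Fin.rev_rev] at this

theorem comap_rev_injective : Function.Injective (SetPartition.comap (n := n) Fin.rev) := by
  intro π σ h
  refine SetPartition.ext fun i j => ?_
  have e : ∀ τ : SetPartition n, SameBlock (τ.comap Fin.rev) i.rev j.rev ↔ SameBlock τ i j :=
    fun τ => by rw [sameBlock_comap, Fin.rev_rev, Fin.rev_rev]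
  rw [← e π, h, e]

variable {R : Type*} [CommRing R]

/-- Over a one-letter alphabet a subword is determined by its length, and reversal preserves block
sizes. -/
theorem coeffPart_comap_rev (f : MSeries 1 R) (w : List (Fin 1)) (π : SetPartition w.length) :
    coeffPart f w (π.comap Fin.rev) = coeffPart f w π := by
  refine Finset.prod_bij (fun V _ => V.map Fin.revPerm.toEmbedding) (fun V hV => ?_)
    (fun V _ W _ h => Finset.map_injective _ h) (fun V hV => ?_) fun V _ => ?_
  · obtain ⟨i, hi⟩ := mem_parts_iff.1 hV
    refine mem_parts_iff.2 ⟨i.rev, fun x => ?_⟩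
    have := hi x.rev
    rw [sameBlock_comap, Fin.rev_rev] at this
    rw [← this]
    simp
  · obtain ⟨i, hi⟩ := mem_parts_iff.1 hV
    refine ⟨V.map Fin.revPerm.toEmbedding, mem_parts_iff.2 ⟨i.rev, fun x => ?_⟩, ?_⟩
    · rw [sameBlock_comap, Fin.rev_rev, ← hi]
      simp
    · ext x
      simp
  · congr 1
    refine List.ext_get (by simp [length_restrictWord]) fun _ _ _ => Subsingleton.elim _ _

theorem boxConv_comm (f g : MSeries 1 R) : boxConv f g = boxConv g f := by
  funext ⟨w, hw⟩
  have hmaps : ∀ π ∈ NC w.length, (kreweras π).comap Fin.rev ∈ NC w.length :=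
    fun π hπ => comap_rev_mem_NC (kreweras_mem_NC hπ)
  have hinj : Set.InjOn (fun π : SetPartition w.length => (kreweras π).comap Fin.rev)
      (NC w.length) := by
    intro π hπ σ hσ h
    exact kreweras_injOn hπ hσ (comap_rev_injective h)
  refine Finset.sum_nbij _ hmaps hinj
    (Finset.surjOn_of_injOn_of_card_le _ hmaps hinj le_rfl) fun π hπ => ?_
  rw [kreweras_comap_rev hπ, coeffPart_comap_rev, coeffPart_comap_rev, mul_comm]

theorem isAbelianOn_boxTimesV {s : ℕ} (hs : s = 1) :
    IsAbelianOn (GSeries s R) boxTimesV := by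
  subst hs
  intro f _ g _
  rw [boxTimesV, boxTimesV, boxConv_assoc, boxConv_comm f, boxConv_comm (Moeb 1 R)]

end OneVariable

/-! ### Non-commutativity in several variables -/

section SeveralVariables

variable {s : ℕ} {R : Type*} [CommRing R]

/-- The series `z₁ + ⋯ + z_s + z_u z_v`. -/
def pairSeries (R : Type*) [CommRing R] (u v : Fin s) : MSeries s R :=
  fun w => if w.1.length = 1 ∨ w.1 = [u, v] then 1 else 0

theorem pairSeries_mem_GSeries (u v : Fin s) : pairSeries R u v ∈ GSeries s R := fun i => by
  simp [pairSeries]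

theorem coeffAt_pairSeries (u v : Fin s) (w : List (Fin s)) :
    coeffAt (pairSeries R u v) w = if w.length = 1 ∨ w = [u, v] then 1 else 0 := by
  by_cases h : w = []
  · simp [coeffAt, h]
  · rw [coeffAt_of_ne_nil _ h, pairSeries]

/-- A non-vanishing coefficient allows only singletons and blocks spelling `uv` in `π`; by `hk` the
latter avoid `k`, so `k` is alone in its block. -/
theorem ne_of_coeffPart_pairSeries_ne_zero {u v : Fin s} {w : List (Fin s)}
    {π : SetPartition w.length} {k : Fin w.length}
    (hk : ∀ V, restrictWord w V = [u, v] → V = {k}ᶜ)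
    (h : coeffPart (pairSeries R u v) w π ≠ 0) {i j : Fin w.length}
    (hij : SameBlock π i j) (hne : i ≠ j) : i ≠ k ∧ j ≠ k := by
  obtain ⟨V, hV, hi, hj⟩ := hij
  by_cases hc : restrictWord w V = [u, v]
  · rw [hk V hc] at hi hj
    simpa using And.intro hi hj
  · refine absurd (Finset.prod_eq_zero hV ?_) h
    rw [coeffAt_pairSeries, if_neg]
    rintro (h1 | h1)
    · rw [length_restrictWord] at h1
      exact hne (Finset.card_le_one.1 h1.le i hi j hj)
    · exact hc h1

theorem coeffPart_pairSeries_eq_one {u v : Fin s} {w : List (Fin s)}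
    {π : SetPartition w.length} {k : Fin w.length} (hk : restrictWord w {k}ᶜ = [u, v])
    (h : ∀ i j, SameBlock π i j ↔ (i = k ↔ j = k)) : coeffPart (pairSeries R u v) w π = 1 := by
  refine Finset.prod_eq_one fun V hV => ?_
  obtain ⟨i, hi⟩ := mem_parts_iff.1 hV
  rw [coeffAt_pairSeries, if_pos]
  by_cases hik : i = k
  · have : V = {k} := by
      ext x
      rw [hi, h]
      simp [hik]
    left
    rw [this, restrictWord_singleton, List.length_singleton]
  · have : V = {k}ᶜ := by
      ext x
      rw [hi, h]
      simp [hik]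
    right
    rw [this, hk]

theorem restrictWord_pair (w : List (Fin s)) {i j : Fin w.length} (h : i < j) :
    restrictWord w {i, j} = [w.get i, w.get j] := by
  rw [restrictWord, Finset.sort_insert _ (by simpa using h.le) (by simpa using h.ne)]
  simp

theorem restrictWord_three {x y u v : Fin s} {V : Finset (Fin 3)}
    (h : restrictWord [x, y, x] V = [u, v]) :
    (V = {2}ᶜ ∧ x = u ∧ y = v) ∨ (V = {0}ᶜ ∧ y = u ∧ x = v) ∨ (V = {1}ᶜ ∧ x = u ∧ x = v) := by
  have hc : V.card = 2 := by
    rw [← length_restrictWord (s := s) [x, y, x] V, h]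
    rfl
  have cases : ∀ V : Finset (Fin 3), V.card = 2 → (V = {0, 1} ∧ V = {2}ᶜ) ∨
      (V = {1, 2} ∧ V = {0}ᶜ) ∨ (V = {0, 2} ∧ V = {1}ᶜ) := by decide
  rcases cases V hc with ⟨h₁, h₂⟩ | ⟨h₁, h₂⟩ | ⟨h₁, h₂⟩
  · rw [h₁, restrictWord_pair [x, y, x] (i := (0 : Fin 3)) (j := (1 : Fin 3))
      (show (0 : Fin 3) < 1 by decide)] at h
    exact Or.inl ⟨h₂, by simpa using h⟩
  · rw [h₁, restrictWord_pair [x, y, x] (i := (1 : Fin 3)) (j := (2 : Fin 3))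
      (show (1 : Fin 3) < 2 by decide)] at h
    exact Or.inr (Or.inl ⟨h₂, by simpa using h⟩)
  · rw [h₁, restrictWord_pair [x, y, x] (i := (0 : Fin 3)) (j := (2 : Fin 3))
      (show (0 : Fin 3) < 2 by decide)] at h
    exact Or.inr (Or.inr ⟨h₂, by simpa using h⟩)

/-- In `xyx` the subword `xy` occurs only at positions `0, 1` and `yx` only at `1, 2`. The one
contributing partition is `{0,1},{2}`, whose complement is `{0},{1,2}`. -/
theorem boxConv_pairSeries_eq_one {x y : Fin s} (hxy : x ≠ y) :
    boxConv (pairSeries R x y) (pairSeries R y x) ⟨[x, y, x], List.cons_ne_nil _ _⟩ = 1 := by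
  have hk₂ : ∀ V : Finset (Fin 3), restrictWord [x, y, x] V = [x, y] → V = {2}ᶜ := by
    intro V h
    rcases restrictWord_three h with h | h | h
    · exact h.1
    · exact absurd h.2.2 hxy
    · exact absurd h.2.2 hxy
  have hk₀ : ∀ V : Finset (Fin 3), restrictWord [x, y, x] V = [y, x] → V = {0}ᶜ := by
    intro V h
    rcases restrictWord_three h with h | h | h
    · exact absurd h.2.1 hxy
    · exact h.1
    · exact absurd h.2.1 hxy
  have hr₂ : restrictWord [x, y, x] (({2}ᶜ : Finset (Fin 3))) = [x, y] :=
    restrictWord_pair [x, y, x] (i := (0 : Fin 3)) (j := (1 : Fin 3))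
      (show (0 : Fin 3) < 1 by decide)
  have hr₀ : restrictWord [x, y, x] (({0}ᶜ : Finset (Fin 3))) = [y, x] :=
    restrictWord_pair [x, y, x] (i := (1 : Fin 3)) (j := (2 : Fin 3))
      (show (1 : Fin 3) < 2 by decide)
  let r : Setoid (Fin 3) := Setoid.ker fun i => decide (i = 2)
  let ρ : SetPartition 3 := setPartitionOf r
  have hρ : ∀ i j, SameBlock ρ i j ↔ (i = 2 ↔ j = 2) := fun i j =>
    sameBlock_setPartitionOf.trans (by simp [r])
  have hKρ : ∀ i j, SameBlock (kreweras ρ) i j ↔ (i = 0 ↔ j = 0) := by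
    intro i j
    rw [sameBlock_kreweras]
    change (∀ a b, SameBlock ρ a b → _) ↔ _
    simp only [hρ]
    revert i j
    decide
  have hNC : ρ ∈ NC 3 := by
    rw [mem_NC]
    intro p₁ q₁ p₂ q₂ h₁ h₂ h₃
    omega
  have key : ∀ π : SetPartition 3, coeffPart (pairSeries R x y) [x, y, x] π ≠ 0 →
      coeffPart (pairSeries R y x) [x, y, x] (kreweras π) ≠ 0 → π = ρ := by
    intro π h₁ h₂
    have h₁ : ∀ i j : Fin 3, SameBlock π i j → i ≠ j → i ≠ 2 ∧ j ≠ 2 :=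
      fun i j => ne_of_coeffPart_pairSeries_ne_zero (w := [x, y, x]) hk₂ h₁
    have h₂ : ∀ i j : Fin 3, SameBlock (kreweras π) i j → i ≠ j → i ≠ 0 ∧ j ≠ 0 :=
      fun i j => ne_of_coeffPart_pairSeries_ne_zero (w := [x, y, x]) hk₀ h₂
    have h01 : SameBlock π 0 1 := by
      by_contra hc
      -- If `0` and `1` were not joined, `π` would be discrete and its complement would join `0` and
      -- `2`.
      refine (h₂ 0 2 ((sameBlock_kreweras _ _ _).2 fun a b hab => ?_) (by decide)).1 rfl
      have hab' : a = b := by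
        by_contra hne
        have := h₁ a b hab hne
        obtain ⟨rfl, rfl⟩ | ⟨rfl, rfl⟩ : (a = 0 ∧ b = 1) ∨ (a = 1 ∧ b = 0) := by omega
        · exact hc hab
        · exact hc hab.symm
      rw [hab']
    refine SetPartition.ext fun i j => ?_
    rw [hρ]
    constructor
    · intro h
      by_cases hij : i = j
      · rw [hij]
      · exact iff_of_false (h₁ i j h hij).1 (h₁ i j h hij).2
    · intro h
      by_cases hij : i = j
      · exact hij ▸ .refl π i
      · obtain ⟨rfl, rfl⟩ | ⟨rfl, rfl⟩ : (i = 0 ∧ j = 1) ∨ (i = 1 ∧ j = 0) := by omega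
        · exact h01
        · exact h01.symm
  change ∑ π ∈ NC 3, coeffPart (pairSeries R x y) [x, y, x] π *
    coeffPart (pairSeries R y x) [x, y, x] (kreweras π) = 1
  rw [Finset.sum_eq_single_of_mem ρ hNC]
  · rw [coeffPart_pairSeries_eq_one (w := [x, y, x]) hr₂ hρ,
      coeffPart_pairSeries_eq_one (w := [x, y, x]) hr₀ hKρ, mul_one]
  · intro π _ hπ
    by_contra h
    exact hπ (key π (left_ne_zero_of_mul h) (right_ne_zero_of_mul h))

theorem boxConv_pairSeries_eq_zero {x y : Fin s} (hxy : x ≠ y) :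
    boxConv (pairSeries R y x) (pairSeries R x y) ⟨[x, y, x], List.cons_ne_nil _ _⟩ = 0 := by
  have hk₂ : ∀ V : Finset (Fin 3), restrictWord [x, y, x] V = [x, y] → V = {2}ᶜ := by
    intro V h
    rcases restrictWord_three h with h | h | h
    · exact h.1
    · exact absurd h.2.2 hxy
    · exact absurd h.2.2 hxy
  have hk₀ : ∀ V : Finset (Fin 3), restrictWord [x, y, x] V = [y, x] → V = {0}ᶜ := by
    intro V h
    rcases restrictWord_three h with h | h | h
    · exact absurd h.2.1 hxy
    · exact h.1
    · exact absurd h.2.1 hxy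
  have key : ∀ π : SetPartition 3, coeffPart (pairSeries R y x) [x, y, x] π ≠ 0 →
      coeffPart (pairSeries R x y) [x, y, x] (kreweras π) ≠ 0 → False := by
    intro π h₁ h₂
    have h₁ : ∀ i j : Fin 3, SameBlock π i j → i ≠ j → i ≠ 0 ∧ j ≠ 0 :=
      fun i j => ne_of_coeffPart_pairSeries_ne_zero (w := [x, y, x]) hk₀ h₁
    have h₂ : ∀ i j : Fin 3, SameBlock (kreweras π) i j → i ≠ j → i ≠ 2 ∧ j ≠ 2 :=
      fun i j => ne_of_coeffPart_pairSeries_ne_zero (w := [x, y, x]) hk₂ h₂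
    -- `π` can join only `1` and `2`, both in `(0, 2]`, so `K(π)` joins `0` and `2`, although `2`
    -- must be isolated there.
    refine (h₂ 0 2 ((sameBlock_kreweras _ _ _).2 fun a b hab => ?_) (by decide)).2 rfl
    by_cases hne : a = b
    · rw [hne]
    · have := h₁ a b hab hne
      omega
  refine Finset.sum_eq_zero fun π _ => ?_
  by_contra h
  exact key π (left_ne_zero_of_mul h) (right_ne_zero_of_mul h)

theorem not_isAbelianOn_boxTimesV (hs : 2 ≤ s) [Nontrivial R] :
    ¬ IsAbelianOn (GSeries s R) boxTimesV := by
  intro h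
  have hxy : (⟨0, by omega⟩ : Fin s) ≠ ⟨1, by omega⟩ := by simp
  generalize (⟨0, by omega⟩ : Fin s) = x, (⟨1, by omega⟩ : Fin s) = y at hxy
  -- Multiplying both series by `Zeta` turns commutation under `boxTimesV` into commutation under
  -- `⊠`, which fails at `xyx`.
  have h₁ := h _ (boxConv_mem_GSeries (pairSeries_mem_GSeries x y) zeta_mem_GSeries)
    _ (boxConv_mem_GSeries (pairSeries_mem_GSeries y x) zeta_mem_GSeries)
  rw [boxTimesV_boxConv_zeta, boxTimesV_boxConv_zeta] at h₁
  have h₂ := congrArg (fun f => boxConv f (Moeb s R)) h₁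
  simp only [boxConv_zeta_moeb] at h₂
  have h₃ := congrFun h₂ ⟨[x, y, x], List.cons_ne_nil _ _⟩
  rw [boxConv_pairSeries_eq_one hxy, boxConv_pairSeries_eq_zero hxy] at h₃
  exact one_ne_zero h₃

end SeveralVariables

theorem mainTheorem11 (k : Type*) [CommRing k] (s : ℕ) (hs : 1 ≤ s)
    (R : Type*) [CommRing R] [Algebra k R] :
    -- `Moeb_s`, which enters both operations, is the unique two-sided `⊠`-inverse of `Zeta_s`
    (∀ m : MSeries s R, IsMoebius m ↔ m = Moeb s R) ∧
    -- `(𝔐ˢ(R), ⊞_V)` is an abelian group with neutral element `0`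
    (IsGroupOn (Set.univ : Set (MSeries s R)) boxPlusV 0 ∧
      IsAbelianOn (Set.univ : Set (MSeries s R)) boxPlusV) ∧
    -- `(𝔊ˢ(R), ⊠_V)` is a group with neutral element `Zeta_s`, abelian exactly for `s = 1`
    (IsGroupOn (GSeries s R) boxTimesV (Zeta s R) ∧
      (s = 1 → IsAbelianOn (GSeries s R) boxTimesV) ∧
      (2 ≤ s → Nontrivial R → ¬ IsAbelianOn (GSeries s R) boxTimesV)) ∧
    -- `(𝔐ˢ(R), +)` and `(𝔊ˢ(R), ⊠)` are groups, and `f ↦ f ⊠ Zeta_s` is an isomorphism from them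
    -- onto `(𝔐ˢ(R), ⊞_V)` and `(𝔊ˢ(R), ⊠_V)`
    (IsGroupOn (Set.univ : Set (MSeries s R)) (fun f g => f + g) 0 ∧
      IsGroupOn (GSeries s R) boxConv (boxUnit s R) ∧
      IsGroupIsoOn (Set.univ : Set (MSeries s R)) (fun f g => f + g) Set.univ boxPlusV
        (fun f => boxConv f (Zeta s R)) ∧
      IsGroupIsoOn (GSeries s R) boxConv (GSeries s R) boxTimesV
        (fun f => boxConv f (Zeta s R))) ∧
    -- naturality: `𝔐ˢ(φ)` and its restriction to `𝔊ˢ(R)` are homomorphisms for all these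
    -- operations, and they commute with `f ↦ f ⊠ Zeta_s`
    (∀ (R' : Type*) [CommRing R'] [Algebra k R'] (φ : R →ₐ[k] R'),
      Set.MapsTo (MSeries.map φ) (GSeries s R) (GSeries s R') ∧
      (∀ f g : MSeries s R,
        MSeries.map φ (f + g) = MSeries.map φ f + MSeries.map φ g ∧
        MSeries.map φ (boxConv f g) = boxConv (MSeries.map φ f) (MSeries.map φ g) ∧
        MSeries.map φ (boxPlusV f g) = boxPlusV (MSeries.map φ f) (MSeries.map φ g) ∧
        MSeries.map φ (boxTimesV f g) = boxTimesV (MSeries.map φ f) (MSeries.map φ g)) ∧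
      ∀ f : MSeries s R,
        MSeries.map φ (boxConv f (Zeta s R)) = boxConv (MSeries.map φ f) (Zeta s R')) := by
  refine ⟨fun m => ⟨fun h => h.unique isMoebius_moeb, fun h => h ▸ isMoebius_moeb⟩,
    ⟨isGroupOn_boxPlusV, fun f _ g _ => by rw [boxPlusV, boxPlusV, add_comm]⟩,
    ⟨isGroupOn_boxTimesV, isAbelianOn_boxTimesV, fun hs _ => not_isAbelianOn_boxTimesV hs⟩,
    ⟨isGroupOn_add, isGroupOn_boxConv,
      ⟨bijOn_boxConv_zeta (fun _ _ => trivial) fun _ _ => trivial,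
        fun f _ g _ => (boxPlusV_boxConv_zeta f g).symm⟩,
      bijOn_boxConv_zeta (fun _ hf => boxConv_mem_GSeries hf zeta_mem_GSeries)
        fun _ hf => boxConv_mem_GSeries hf moeb_mem_GSeries,
      fun f _ g _ => (boxTimesV_boxConv_zeta f g).symm⟩, ?_⟩
  intro R' _ _ φ
  refine ⟨fun f hf i => (hf i).map φ, fun f g => ⟨MSeries.map_add' φ.toRingHom f g,
    map_boxConv φ.toRingHom f g, map_boxPlusV φ.toRingHom f g, map_boxTimesV φ.toRingHom f g⟩,
    fun f => ?_⟩
  rw [← map_zeta φ.toRingHom]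
  exact map_boxConv φ.toRingHom f (Zeta s R)
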